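/- Let $(R,\mathfrak m)$ be a complete regular local ring of dimension $d$ and let $A$ be a commutative $R$-algebra. Then $A$ is parasolid over $R$ if and only if $R$ is a direct summand of $A$ (that is, $R\to A$ is injective and $A=R\oplus V$ for some $R$-submodule $V\subseteq A$). Here elements $x_1,\dots,x_d\in R$ with $V(x_1,\dots,x_d)=V(\mathfrak m)$, $d=\dim R$, are called parameters. For an $R$-module $M$ the local cohomology $H^d_{\mathfrak m}(M)$ is computed by the Čech complex of $x_1,\dots,x_d$, i.e. as the cokernel of its last differential $\bigoplus_{i} M_{x_1\cdots \widehat{x_i}\cdots x_d}\to M_{x_1\cdots x_d}$, and the class $1/(x_1\cdots x_d)\in H^d_{\mathfrak m}(R)$ is called the paraclass of $x_1,\dots,x_d$. The $R$-algebra $A$ is called parasolid if every paraclass $0\neq c\in H^d_{\mathfrak m}(R)$ (for all systems of parameters) has nonzero image in $H^d_{\mathfrak m}(A)$. -/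

import Mathlib

noncomputable section

namespace Parasolid

open IsLocalRing

variable {R : Type*} [CommRing R]

/-- If `a` divides `b`, then every power of `a` acts bijectively on the localization `M_b`. -/
theorem isUnit_end_of_dvd (M : Type*) [AddCommGroup M] [Module R M] {a b : R} (h : a ∣ b)
    (s : Submonoid.powers a) :
    IsUnit (algebraMap R (Module.End R (LocalizedModule (Submonoid.powers b) M)) s) := by
  obtain ⟨_, n, rfl⟩ := s
  have hb := IsLocalizedModule.map_units (LocalizedModule.mkLinearMap (Submonoid.powers b) M)
    ⟨b, Submonoid.mem_powers b⟩
  obtain ⟨c, rfl⟩ := h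
  simp only [map_mul] at hb
  simp only [map_pow]
  exact ((Commute.isUnit_mul_iff
    (by rw [commute_iff_eq, ← map_mul, ← map_mul, mul_comm])).1 hb).1.pow n

/-- The canonical restriction map `M_a → M_b` between localizations, for `a ∣ b`. -/
def awayMap (M : Type*) [AddCommGroup M] [Module R M] {a b : R} (h : a ∣ b) :
    LocalizedModule (Submonoid.powers a) M →ₗ[R] LocalizedModule (Submonoid.powers b) M :=
  LocalizedModule.lift (Submonoid.powers a) (LocalizedModule.mkLinearMap (Submonoid.powers b) M)
    (isUnit_end_of_dvd M h)

/-- The term `M_{x_1 ⋯ x_d}` in (top) degree `d` of the Čech complex of `M` with respect to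
`x_1, …, x_d`. -/
abbrev CechTop {d : ℕ} (x : Fin d → R) (M : Type*) [AddCommGroup M] [Module R M] :=
  LocalizedModule (Submonoid.powers (∏ j, x j)) M

/-- The `i`-th summand `M_{x_1 ⋯ x̂_i ⋯ x_d}` of the term in degree `d - 1` of the Čech complex
of `M` with respect to `x_1, …, x_d`. -/
abbrev CechPre {d : ℕ} (x : Fin d → R) (M : Type*) [AddCommGroup M] [Module R M] (i : Fin d) :=
  LocalizedModule (Submonoid.powers (∏ j ∈ Finset.univ.erase i, x j)) M

/-- The last differential
`⨁ i, M_{x_1 ⋯ x̂_i ⋯ x_d} → M_{x_1 ⋯ x_d}`, `(m_i)_i ↦ ∑ i, (-1)^i m_i`,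
of the Čech complex of `M` with respect to `x_1, …, x_d`. For `d = 0` its source is zero. -/
def cechDifferential {d : ℕ} (x : Fin d → R) (M : Type*) [AddCommGroup M] [Module R M] :
    (∀ i : Fin d, CechPre x M i) →ₗ[R] CechTop x M :=
  ∑ i : Fin d, (-1 : R) ^ (i : ℕ) •
    (awayMap M (Finset.prod_dvd_prod_of_subset _ _ x (Finset.erase_subset i Finset.univ)) ∘ₗ
      LinearMap.proj i)

/-- The top Čech cohomology `H^d(x_1, …, x_d; M)`, i.e. the cokernel of the last differential of
the Čech complex (whose term in degree `d + 1` is zero). When `x_1, …, x_d` is a system of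
parameters of a Noetherian local ring `(R, 𝔪)`, this is the local cohomology `H^d_𝔪(M)`. -/
abbrev TopCohomology {d : ℕ} (x : Fin d → R) (M : Type*) [AddCommGroup M] [Module R M] :=
  CechTop x M ⧸ LinearMap.range (cechDifferential x M)

/-- The map `M_b → N_b` induced by an `R`-linear map `f : M → N`. -/
def localizedMap {M N : Type*} [AddCommGroup M] [Module R M] [AddCommGroup N] [Module R N]
    (b : R) (f : M →ₗ[R] N) :
    LocalizedModule (Submonoid.powers b) M →ₗ[R] LocalizedModule (Submonoid.powers b) N :=
  IsLocalizedModule.map (Submonoid.powers b)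
    (LocalizedModule.mkLinearMap (Submonoid.powers b) M)
    (LocalizedModule.mkLinearMap (Submonoid.powers b) N) f

theorem localizedMap_awayMap {M N : Type*} [AddCommGroup M] [Module R M] [AddCommGroup N]
    [Module R N] (f : M →ₗ[R] N) {a b : R} (h : a ∣ b)
    (z : LocalizedModule (Submonoid.powers a) M) :
    localizedMap b f (awayMap M h z) = awayMap N h (localizedMap a f z) := by
  have key : localizedMap b f ∘ₗ awayMap M h = awayMap N h ∘ₗ localizedMap a f := by
    refine IsLocalizedModule.ext (Submonoid.powers a)
      (LocalizedModule.mkLinearMap (Submonoid.powers a) M) (isUnit_end_of_dvd N h) ?_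
    ext m
    have e1 : ∀ m : M, awayMap M h (LocalizedModule.mkLinearMap (Submonoid.powers a) M m) =
        LocalizedModule.mkLinearMap (Submonoid.powers b) M m := fun m =>
      congrArg (fun g => g m) (LocalizedModule.lift_comp (Submonoid.powers a)
        (LocalizedModule.mkLinearMap (Submonoid.powers b) M) (isUnit_end_of_dvd M h))
    have e2 : ∀ n : N, awayMap N h (LocalizedModule.mkLinearMap (Submonoid.powers a) N n) =
        LocalizedModule.mkLinearMap (Submonoid.powers b) N n := fun n =>
      congrArg (fun g => g n) (LocalizedModule.lift_comp (Submonoid.powers a)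
        (LocalizedModule.mkLinearMap (Submonoid.powers b) N) (isUnit_end_of_dvd N h))
    simp only [LinearMap.comp_apply, e1, localizedMap, IsLocalizedModule.map_apply, e2]
  exact LinearMap.congr_fun key z

theorem range_cechDifferential_le {d : ℕ} (x : Fin d → R) {M N : Type*} [AddCommGroup M]
    [Module R M] [AddCommGroup N] [Module R N] (f : M →ₗ[R] N) :
    LinearMap.range (cechDifferential x M) ≤
      (LinearMap.range (cechDifferential x N)).comap (localizedMap (∏ j, x j) f) := by
  rintro _ ⟨m, rfl⟩
  refine ⟨fun i => localizedMap _ f (m i), ?_⟩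
  simp [cechDifferential, LinearMap.sum_apply, map_sum, localizedMap_awayMap]

/-- The map `H^d(x_1, …, x_d; M) → H^d(x_1, …, x_d; N)` induced by an `R`-linear map `M → N`. -/
def topCohomologyMap {d : ℕ} (x : Fin d → R) {M N : Type*} [AddCommGroup M] [Module R M]
    [AddCommGroup N] [Module R N] (f : M →ₗ[R] N) : TopCohomology x M →ₗ[R] TopCohomology x N :=
  Submodule.mapQ _ _ (localizedMap (∏ j, x j) f) (range_cechDifferential_le x f)

/-- The paraclass (canonical element) `1 / (x_1 ⋯ x_d)` in `H^d(x_1, …, x_d; R)`. -/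
def paraclass {d : ℕ} (x : Fin d → R) : TopCohomology x R :=
  Submodule.Quotient.mk (LocalizedModule.mk 1 ⟨∏ j, x j, Submonoid.mem_powers _⟩)

/-- `x_1, …, x_d` are parameters of the local ring `(R, 𝔪)`: `d = dim R` and
`V(x_1, …, x_d) = V(𝔪)`. -/
def IsSystemOfParameters [IsLocalRing R] {d : ℕ} (x : Fin d → R) : Prop :=
  ringKrullDim R = d ∧
    PrimeSpectrum.zeroLocus (Set.range x) =
      PrimeSpectrum.zeroLocus (maximalIdeal R : Set R)

/-- An algebra `A` over a Noetherian local ring `(R, 𝔪)` of dimension `d` is parasolid if every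
paraclass `c ≠ 0` in `H^d_𝔪(R)` has nonzero image in `H^d_𝔪(A)`. -/
def IsParasolid (R A : Type*) [CommRing R] [IsLocalRing R] [IsNoetherianRing R] [CommRing A]
    [Algebra R A] : Prop :=
  ∀ (d : ℕ) (x : Fin d → R), IsSystemOfParameters x → paraclass x ≠ 0 →
    topCohomologyMap x (Algebra.linearMap R A) (paraclass x) ≠ 0

/-- `R` is a direct summand of the `R`-algebra `A`: the structure map `R → A` is injective, and
its image has a complementary `R`-submodule `V`, i.e. `A = R ⊕ V` as `R`-modules. -/
def IsDirectSummand (R A : Type*) [CommRing R] [CommRing A] [Algebra R A] : Prop :=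
  Function.Injective (algebraMap R A) ∧
    ∃ V : Submodule R A, IsCompl (LinearMap.range (Algebra.linearMap R A)) V

end Parasolid

end

/-!
Let `x_1, …, x_d` generate the maximal ideal `𝔪` of the regular local ring `R`, let
`I_t = (x_1 ^ t, …, x_d ^ t)`, and let `E = H^d_𝔪(R)` be the top Čech cohomology, with the elements
`e_t = 1 / (x_1 ⋯ x_d) ^ t`.

Regular local rings are domains (`IsRegularLocalRing.isDomain`), so each `x_i` is a nonzerodivisor
modulo any of the others, and hence modulo powers of them (`mem_powerIdeal_of_mul_mem`). This gives
that the annihilator of `e_t` is exactly `I_t` (`smul_cechClass_eq_zero_iff`), and that the socle of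
`R ⧸ I_t` is generated by `(x_1 ⋯ x_d) ^ (t - 1)`. Therefore `E` is the union of its submodules
`R e_t ≅ R ⧸ I_t`, and its socle is the simple module generated by the paraclass `e_1`
(`isSocleGenerator_paraclass`). A comparison of lengths shows that such a module `E` is injective
(`IsSocleGenerator.baer`) and that `R e_t` is all of the `I_t`-torsion of `E`
(`IsSocleGenerator.exists_eq_smul`).

If `A` is parasolid, the kernel of `E → H^d_𝔪(A)` does not contain `e_1`. As every nonzero submodule
of `E` contains `e_1`, the map is injective, and by injectivity of `E` it has a retraction `ψ`. For
`a ∈ A` the element `ψ (a / (x_1 ⋯ x_d) ^ t)` is killed by `I_t`, so it is `r_t e_t` for a unique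
`r_t ∈ R ⧸ I_t`. These residues are compatible and define, by completeness, an element of `R`; the
resulting `R`-linear map `A → R` sends `1` to `1` (`exists_retraction`). Conversely, a retraction
`A → R` of the structure map carries the image of a paraclass in `H^d_𝔪(A)` back to the paraclass.
-/

/-! ### Regular local rings are domains -/

namespace IsLocalRing

theorem exists_ringKrullDim_eq_natCast (R : Type*) [CommRing R] [IsLocalRing R]
    [IsNoetherianRing R] : ∃ n : ℕ, ringKrullDim R = n := by
  refine ⟨(maximalIdeal R).height.toNat, ?_⟩
  rw [← maximalIdeal_height_eq_ringKrullDim, ← WithBot.coe_natCast,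
    ENat.natCast_toNat (Ideal.height_ne_top Ideal.IsPrime.ne_top')]

theorem isLocalRing_quotient_of_le {R : Type*} [CommRing R] [IsLocalRing R] {I : Ideal R}
    (hI : I ≤ maximalIdeal R) : IsLocalRing (R ⧸ I) :=
  have : Nontrivial (R ⧸ I) := Ideal.Quotient.nontrivial_iff.2
    (ne_top_of_le_ne_top Ideal.IsPrime.ne_top' hI)
  .of_surjective' _ Ideal.Quotient.mk_surjective

end IsLocalRing

namespace IsRegularLocalRing

open IsLocalRing

theorem exists_span_range_eq {R : Type*} [CommRing R] [IsRegularLocalRing R] {n : ℕ}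
    (h : ringKrullDim R = n) :
    ∃ x : Fin n → R, Ideal.span (Set.range x) = maximalIdeal R := by
  have h0 : (maximalIdeal R).spanFinrank = n := by
    exact_mod_cast (IsRegularLocalRing.spanFinrank_maximalIdeal (R := R)).trans h
  obtain ⟨s, hs, hspan⟩ := Submodule.FG.exists_span_finset_card_eq_spanFinrank
    (IsNoetherian.noetherian (maximalIdeal R))
  refine ⟨fun i ↦ (s.equivFinOfCardEq (hs.trans h0)).symm i, .trans ?_ hspan⟩
  rw [Set.range_comp' Subtype.val, Equiv.range_eq_univ, Set.image_univ, Subtype.range_coe]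

/-- Killing part of a regular system of parameters lowers the dimension by the number of elements
killed, and leaves a regular local ring. -/
theorem quotient_span_image {R : Type*} [CommRing R] [IsLocalRing R] [IsNoetherianRing R]
    {ι : Type*} [Fintype ι] [DecidableEq ι] (x : ι → R)
    (hx : Ideal.span (Set.range x) = maximalIdeal R)
    (hd : ((Fintype.card ι : ℕ) : WithBot ℕ∞) ≤ ringKrullDim R) (T : Finset ι) :
    IsRegularLocalRing (R ⧸ Ideal.span (x '' T)) ∧
      ringKrullDim (R ⧸ Ideal.span (x '' T)) = (Tᶜ.card : ℕ) := by
  have hmem (i : ι) : x i ∈ maximalIdeal R := hx ▸ Ideal.subset_span ⟨i, rfl⟩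
  have hle : Ideal.span (x '' T) ≤ maximalIdeal R := by
    rw [Ideal.span_le]
    rintro _ ⟨i, -, rfl⟩
    exact hmem i
  have := isLocalRing_quotient_of_le hle
  obtain ⟨n, hn⟩ := exists_ringKrullDim_eq_natCast (R ⧸ Ideal.span (x '' T))
  have h1 : Fintype.card ι ≤ n + T.card := by
    have h := ringKrullDim_le_ringKrullDim_quotient_add_encard (x '' T) (by
      rw [ringJacobson_eq_maximalIdeal]
      exact Ideal.span_le.1 hle)
    have h' : (x '' T).encard ≤ T.card := by
      simpa using Set.encard_image_le x T
    have h'' := hd.trans (h.trans (add_le_add_right (WithBot.coe_le_coe.2 h') _))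
    rw [hn] at h''
    exact_mod_cast h''
  have h2 : (maximalIdeal (R ⧸ Ideal.span (x '' T))).spanFinrank ≤ Tᶜ.card := by
    have : maximalIdeal (R ⧸ Ideal.span (x '' T)) =
        Ideal.span ((Ideal.Quotient.mk _ ∘ x) '' (Tᶜ : Finset ι)) := by
      have : IsLocalHom (Ideal.Quotient.mk (Ideal.span (x '' T))) :=
        IsLocalHom.of_surjective _ Ideal.Quotient.mk_surjective
      rw [← map_maximalIdeal_of_surjective (Ideal.Quotient.mk (Ideal.span (x '' T)))
        Ideal.Quotient.mk_surjective, ← hx, Ideal.map_span]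
      refine le_antisymm (Ideal.span_le.2 ?_) (Ideal.span_mono ?_)
      · rintro _ ⟨_, ⟨i, rfl⟩, rfl⟩
        by_cases hi : i ∈ T
        · rw [Ideal.Quotient.eq_zero_iff_mem.2 (Ideal.subset_span (Set.mem_image_of_mem x hi))]
          exact zero_mem _
        · exact Ideal.subset_span ⟨i, by simpa using hi, rfl⟩
      · rintro _ ⟨i, -, rfl⟩
        exact ⟨_, ⟨i, rfl⟩, rfl⟩
    rw [this]
    refine (Submodule.spanFinrank_span_le_ncard_of_finite (Set.toFinite _)).trans ?_
    refine (Set.ncard_image_le (Set.toFinite _)).trans ?_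
    rw [Set.ncard_coe_finset]
  have h3 := T.card_add_card_compl
  have h4 : n ≤ (maximalIdeal (R ⧸ Ideal.span (x '' T))).spanFinrank := by
    exact_mod_cast hn ▸ ringKrullDim_le_spanFinrank_maximalIdeal _
  exact ⟨of_spanFinrank_maximalIdeal_le _ (by rw [hn]; exact_mod_cast h2.trans (by lia)),
    by rw [hn]; exact_mod_cast (by lia)⟩

/-- An element outside `𝔪 ^ 2` can be exchanged for a member of any finite generating family
of `𝔪`. -/
theorem exists_span_range_update_eq {R : Type*} [CommRing R] [IsLocalRing R]
    {ι : Type*} [Fintype ι] [DecidableEq ι] {x : ι → R}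
    (hx : Ideal.span (Set.range x) = maximalIdeal R) {y : R} (hy : y ∈ maximalIdeal R)
    (hy2 : y ∉ maximalIdeal R ^ 2) :
    ∃ i, Ideal.span (Set.range (Function.update x i y)) = maximalIdeal R := by
  have hmem (i : ι) : x i ∈ maximalIdeal R := hx ▸ Ideal.subset_span ⟨i, rfl⟩
  obtain ⟨c, hc⟩ := Ideal.mem_span_range_iff_exists_fun.1 (hx.symm ▸ hy)
  obtain ⟨i, hi⟩ : ∃ i, IsUnit (c i) := by
    by_contra! h
    refine hy2 (hc ▸ sum_mem fun i _ ↦ ?_)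
    rw [pow_two]
    exact Ideal.mul_mem_mul ((mem_maximalIdeal _).2 (h i)) (hmem i)
  refine ⟨i, le_antisymm (Ideal.span_le.2 ?_) (hx ▸ Ideal.span_le.2 ?_)⟩
  · rintro _ ⟨j, rfl⟩
    rcases eq_or_ne j i with rfl | h
    · simpa using hy
    · simpa [h] using hmem j
  · have hyi : y ∈ Ideal.span (Set.range (Function.update x i y)) :=
      Ideal.subset_span ⟨i, by simp⟩
    have hj (j : ι) (h : j ≠ i) : x j ∈ Ideal.span (Set.range (Function.update x i y)) :=
      Ideal.subset_span ⟨j, by simp [h]⟩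
    rintro _ ⟨j, rfl⟩
    rcases eq_or_ne j i with rfl | h
    · rw [← Finset.add_sum_erase _ _ (Finset.mem_univ j)] at hc
      have : c j * x j ∈ Ideal.span (Set.range (Function.update x j y)) := by
        rw [eq_sub_of_add_eq hc]
        exact sub_mem hyi (sum_mem fun k hk ↦ Ideal.mul_mem_left _ _
          (hj k (Finset.ne_of_mem_erase hk)))
      exact (Ideal.unit_mul_mem_iff_mem _ hi).1 this
    · exact hj j h

/-- Induction on the dimension: prime avoidance gives `y ∈ 𝔪`, outside `𝔪 ^ 2` and all minimal
primes. Then `R ⧸ (y)` is regular of smaller dimension, so `(y)` is prime, and a minimal prime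
`q ≤ (y)` satisfies `q = y q`, hence vanishes by Nakayama's lemma. -/
theorem isDomain_of_ringKrullDim_eq (n : ℕ) : ∀ (R : Type*) [CommRing R] [IsRegularLocalRing R],
    ringKrullDim R = n → IsDomain R := by
  induction n with
  | zero =>
    intro R _ _ h
    have h0 : (maximalIdeal R).spanFinrank = 0 := by
      exact_mod_cast (IsRegularLocalRing.spanFinrank_maximalIdeal (R := R)).trans h
    rw [Submodule.spanFinrank_eq_zero_iff_eq_bot (IsNoetherian.noetherian _)] at h0
    exact (isField_iff_maximalIdeal_eq.2 h0).isDomain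
  | succ n ih =>
    intro R _ _ h
    have h0 : (maximalIdeal R).spanFinrank = n + 1 := by
      exact_mod_cast (IsRegularLocalRing.spanFinrank_maximalIdeal (R := R)).trans h
    have hht : (maximalIdeal R).height = (n + 1 : ℕ) := by
      exact_mod_cast maximalIdeal_height_eq_ringKrullDim.trans h
    have hne2 : ¬ maximalIdeal R ≤ maximalIdeal R ^ 2 := by
      intro hle
      have := Submodule.eq_bot_of_le_smul_of_le_jacobson_bot (maximalIdeal R) (maximalIdeal R)
        (IsNoetherian.noetherian _) (by rwa [smul_eq_mul, ← pow_two])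
        (jacobson_eq_maximalIdeal _ bot_ne_top).ge
      rw [← Submodule.spanFinrank_eq_zero_iff_eq_bot (IsNoetherian.noetherian _)] at this
      lia
    obtain ⟨y, hy, hyn⟩ : ∃ y ∈ maximalIdeal R,
        y ∉ ⋃ I ∈ insert (maximalIdeal R ^ 2) (minimalPrimes R), (I : Set R) := by
      refine Set.not_subset.1 fun hsub ↦ ?_
      obtain ⟨I, hI | hI, hle⟩ := (Ideal.subset_union_prime_finite (f := id)
        ((minimalPrimes.finite_of_isNoetherianRing R).insert _)
        (maximalIdeal R ^ 2) (maximalIdeal R ^ 2)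
        (fun I hI hne _ ↦ (hI.resolve_left hne).1.1)).1 hsub
      · exact hne2 (hI ▸ hle)
      · have := hI.1.1
        have h1 : I = maximalIdeal R := le_antisymm (le_maximalIdeal this.ne_top) hle
        have h2 : I.height = 0 := Ideal.height_eq_zero_iff.2 hI
        rw [h1, hht] at h2
        exact absurd h2 (by simp)
    simp only [Set.mem_insert_iff, Set.mem_iUnion, SetLike.mem_coe, exists_prop, not_exists,
      not_and, forall_eq_or_imp] at hyn
    obtain ⟨hy2, hymin⟩ := hyn
    obtain ⟨x, hx⟩ := exists_span_range_eq h
    obtain ⟨i, hi⟩ := exists_span_range_update_eq hx hy hy2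
    obtain ⟨hreg, hdim⟩ := quotient_span_image _ hi (by simp [h]) {i}
    have hdom := ih _ (by rw [hdim, Finset.card_compl]; simp)
    rw [Finset.coe_singleton, Set.image_singleton, Function.update_self] at hdom
    have hprime : (Ideal.span {y}).IsPrime := (Ideal.Quotient.isDomain_iff_prime _).1 hdom
    obtain ⟨q, hq, hqy⟩ := Ideal.exists_minimalPrimes_le (bot_le (a := Ideal.span {y}))
    have hqp := hq.1.1
    have hqbot : q = ⊥ := by
      refine Submodule.eq_bot_of_le_smul_of_le_jacobson_bot (maximalIdeal R) q
        (IsNoetherian.noetherian _) (fun z hz ↦ ?_) (jacobson_eq_maximalIdeal _ bot_ne_top).ge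
      obtain ⟨w, rfl⟩ := Ideal.mem_span_singleton'.1 (hqy hz)
      rw [mul_comm]
      exact Ideal.mul_mem_mul hy ((hqp.mem_or_mem hz).resolve_right (hymin q hq))
    exact IsDomain.of_bot_isPrime R (hbp := hqbot ▸ hqp)

theorem isDomain (R : Type*) [CommRing R] [IsRegularLocalRing R] : IsDomain R :=
  have ⟨n, hn⟩ := exists_ringKrullDim_eq_natCast R
  isDomain_of_ringKrullDim_eq n R hn

/-- Any member of a regular system of parameters is a nonzerodivisor modulo the others. -/
theorem mem_span_image_of_mul_mem {R : Type*} [CommRing R] [IsLocalRing R] [IsNoetherianRing R]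
    {ι : Type*} [Fintype ι] [DecidableEq ι] {x : ι → R}
    (hx : Ideal.span (Set.range x) = maximalIdeal R)
    (hd : ((Fintype.card ι : ℕ) : WithBot ℕ∞) ≤ ringKrullDim R) {T : Finset ι} {i : ι}
    (hi : i ∉ T) {r : R} (hr : x i * r ∈ Ideal.span (x '' T)) : r ∈ Ideal.span (x '' T) := by
  obtain ⟨hreg, hdim⟩ := quotient_span_image x hx hd T
  have := isDomain (R ⧸ Ideal.span (x '' T))
  refine (((Ideal.Quotient.isDomain_iff_prime _).1 this).mem_or_mem hr).resolve_left fun h ↦ ?_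
  -- Otherwise killing `x i` as well would not lower the dimension.
  have heq : Ideal.span (x '' (insert i T : Finset ι)) = Ideal.span (x '' T) := by
    rw [Finset.coe_insert, Set.image_insert_eq, Ideal.span_insert, sup_eq_right,
      Ideal.span_singleton_le_iff_mem]
    exact h
  have hdim' := (quotient_span_image x hx hd (insert i T)).2
  rw [heq, hdim, Nat.cast_inj] at hdim'
  have h1 := T.card_add_card_compl
  have h2 := (insert i T).card_add_card_compl
  rw [Finset.card_insert_of_notMem hi] at h2
  lia

end IsRegularLocalRing

/-! ### Ideals generated by powers of parameters -/

namespace Parasolid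

section PowerIdeal

variable {R ι : Type*} [CommRing R]

/-- The ideal `(x_j ^ a_j : j ∈ T)`. -/
def powerIdeal (x : ι → R) (a : ι → ℕ) (T : Finset ι) : Ideal R :=
  Ideal.span ((fun j ↦ x j ^ a j) '' T)

theorem pow_mem_powerIdeal (x : ι → R) (a : ι → ℕ) {T : Finset ι} {j : ι} (hj : j ∈ T) :
    x j ^ a j ∈ powerIdeal x a T :=
  Ideal.subset_span ⟨j, hj, rfl⟩

theorem powerIdeal_mono (x : ι → R) (a : ι → ℕ) {S T : Finset ι} (h : S ⊆ T) :
    powerIdeal x a S ≤ powerIdeal x a T :=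
  Ideal.span_mono (Set.image_mono (by exact_mod_cast h))

theorem powerIdeal_congr (x : ι → R) {a b : ι → ℕ} {T : Finset ι} (h : ∀ j ∈ T, a j = b j) :
    powerIdeal x a T = powerIdeal x b T := by
  rw [powerIdeal, powerIdeal, Set.image_congr fun j hj ↦ by rw [h j hj]]

variable [DecidableEq ι]

theorem mem_powerIdeal_insert (x : ι → R) (a : ι → ℕ) {T : Finset ι} {j : ι} {r : R} :
    r ∈ powerIdeal x a (insert j T) ↔ ∃ c, r - c * x j ^ a j ∈ powerIdeal x a T := by
  rw [powerIdeal, Finset.coe_insert, Set.image_insert_eq, Ideal.mem_span_insert]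
  constructor
  · rintro ⟨c, z, hz, rfl⟩
    exact ⟨c, by simpa using! hz⟩
  · rintro ⟨c, hc⟩
    exact ⟨c, _, hc, by ring⟩

/-- If each `x i` is a nonzerodivisor modulo any set of other members of the family, then it is
one modulo any powers of other members. -/
theorem mem_powerIdeal_of_mul_mem {x : ι → R}
    (hx : ∀ (T : Finset ι), ∀ i ∉ T, ∀ r, x i * r ∈ Ideal.span (x '' T) → r ∈ Ideal.span (x '' T))
    (n : ℕ) : ∀ (T : Finset ι) (a : ι → ℕ), ∑ j ∈ T, a j = n → ∀ i ∉ T, ∀ r,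
      x i * r ∈ powerIdeal x a T → r ∈ powerIdeal x a T := by
  induction n using Nat.strong_induction_on with
  | _ n ih =>
  intro T a ha i hi r hr
  by_cases h0 : ∃ j ∈ T, a j = 0
  · obtain ⟨j, hj, hj0⟩ := h0
    have := pow_mem_powerIdeal x a hj
    rw [hj0, pow_zero] at this
    rw [(Ideal.eq_top_iff_one _).2 this]
    trivial
  by_cases h1 : ∀ j ∈ T, a j = 1
  · have : powerIdeal x a T = Ideal.span (x '' T) := by
      rw [powerIdeal_congr x h1, powerIdeal]
      simp
    rw [this] at hr ⊢
    exact hx T i hi r hr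
  push Not at h0 h1
  -- Lower an exponent `a j ≥ 2`: `x i` is a nonzerodivisor modulo `(J, x j ^ (a j - 1))` and
  -- modulo `(J, x j)`, and `x j` is one modulo `J`.
  obtain ⟨j, hj, hj1⟩ := h1
  have hj2 := h0 j hj
  obtain ⟨T, hjT, rfl⟩ : ∃ T', j ∉ T' ∧ insert j T' = T :=
    ⟨T.erase j, Finset.notMem_erase _ _, Finset.insert_erase hj⟩
  rw [Finset.sum_insert hjT] at ha
  have hiT : i ∉ T := fun h ↦ hi (Finset.mem_insert_of_mem h)
  have hupd (m : ℕ) : powerIdeal x (Function.update a j m) T = powerIdeal x a T :=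
    powerIdeal_congr x fun k hk ↦ Function.update_of_ne (ne_of_mem_of_not_mem hk hjT) _ _
  have hsum (m : ℕ) : ∑ k ∈ insert j T, Function.update a j m k = m + ∑ k ∈ T, a k := by
    rw [Finset.sum_insert hjT, Function.update_self]
    congr 1
    exact Finset.sum_congr rfl fun k hk ↦
      Function.update_of_ne (ne_of_mem_of_not_mem hk hjT) _ _
  have hcancel (m : ℕ) (s : R) (h : x j ^ m * s ∈ powerIdeal x a T) : s ∈ powerIdeal x a T := by
    induction m with
    | zero => simpa using h
    | succ m ihm =>
      rw [pow_succ', mul_assoc] at h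
      exact ihm (ih _ (by lia) T a rfl j hjT _ h)
  obtain ⟨c, hc⟩ := (mem_powerIdeal_insert x a).1 hr
  obtain ⟨k, hk⟩ : ∃ k, a j = k + 1 := ⟨a j - 1, by lia⟩
  have h3 := ih _ (by rw [hsum]; lia) (insert j T) (Function.update a j k) rfl i hi r
    ((mem_powerIdeal_insert _ _).2 ⟨c * x j, by
      rw [hupd, Function.update_self]
      rw [hk] at hc
      convert hc using 1
      ring⟩)
  obtain ⟨s, hs⟩ := (mem_powerIdeal_insert _ _).1 h3
  rw [hupd, Function.update_self] at hs
  have h4 : x i * s - c * x j ∈ powerIdeal x a T := by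
    refine hcancel k _ ?_
    have := sub_mem hc (Ideal.mul_mem_left _ (x i) hs)
    rw [hk] at this
    convert this using 1
    ring
  have h5 := ih _ (by rw [hsum]; lia) (insert j T) (Function.update a j 1) rfl i hi s
    ((mem_powerIdeal_insert _ _).2 ⟨c, by rw [hupd, Function.update_self, pow_one]; exact h4⟩)
  obtain ⟨c', hc'⟩ := (mem_powerIdeal_insert _ _).1 h5
  rw [hupd, Function.update_self, pow_one] at hc'
  refine (mem_powerIdeal_insert _ _).2 ⟨c', ?_⟩
  have := add_mem hs (Ideal.mul_mem_right (x j ^ k) _ hc')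
  rw [hk]
  convert this using 1
  ring

variable [Fintype ι]

open Finset in
/-- A factor `x i ^ m` can be cancelled when the exponent of `x i` in the ideal is lowered by `m`. -/
theorem mem_powerIdeal_univ_of_pow_mul_mem {x : ι → R}
    (hx : ∀ (T : Finset ι), ∀ i ∉ T, ∀ r, x i * r ∈ Ideal.span (x '' T) → r ∈ Ideal.span (x '' T))
    (i : ι) (m : ℕ) {a b : ι → ℕ} (hab : ∀ j ≠ i, b j = a j) (hi : b i = a i + m) {r : R}
    (hr : x i ^ m * r ∈ powerIdeal x b univ) : r ∈ powerIdeal x a univ := by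
  rw [← insert_erase (mem_univ i)] at hr ⊢
  obtain ⟨c, hc⟩ := (mem_powerIdeal_insert _ _).1 hr
  refine (mem_powerIdeal_insert _ _).2 ⟨c, ?_⟩
  rw [powerIdeal_congr x fun j hj ↦ hab j (ne_of_mem_erase hj), hi] at hc
  have hcancel (m : ℕ) (s : R) (h : x i ^ m * s ∈ powerIdeal x a (univ.erase i)) :
      s ∈ powerIdeal x a (univ.erase i) := by
    induction m with
    | zero => simpa using h
    | succ m ihm =>
      rw [pow_succ', mul_assoc] at h
      exact ihm (mem_powerIdeal_of_mul_mem hx _ _ a rfl i (notMem_erase _ _) _ h)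
  refine hcancel m _ ?_
  convert hc using 1
  ring

open Finset in
/-- The colon ideal of `(x_i ^ (t + m))` by `(∏ x_i) ^ m` is contained in `(x_i ^ t)`; this is the
statement that the transition maps between the `R ⧸ (x_i ^ t)` are injective. -/
theorem mem_powerIdeal_of_prod_pow_mul_mem {x : ι → R}
    (hx : ∀ (T : Finset ι), ∀ i ∉ T, ∀ r, x i * r ∈ Ideal.span (x '' T) → r ∈ Ideal.span (x '' T))
    (t m : ℕ) {r : R} (hr : (∏ i, x i) ^ m * r ∈ powerIdeal x (fun _ ↦ t + m) univ) :
    r ∈ powerIdeal x (fun _ ↦ t) univ := by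
  have key (S : Finset ι) : ∀ r, (∏ i ∈ S, x i) ^ m * r ∈
      powerIdeal x (fun j ↦ if j ∈ S then t + m else t) univ →
      r ∈ powerIdeal x (fun _ ↦ t) univ := by
    induction S using Finset.induction_on with
    | empty => simp
    | insert i S hi ih =>
      intro r hr
      rw [prod_insert hi, mul_pow, mul_assoc] at hr
      refine ih r (mem_powerIdeal_univ_of_pow_mul_mem hx i m ?_ ?_ hr)
      · intro j hj
        simp [hj]
      · simp [hi]
  exact key univ r (by simpa using hr)

open Finset in
/-- The socle of `R ⧸ (x_i ^ (t + 1))` is generated by `(∏ x_i) ^ t`, where `(x_i)` is the maximal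
ideal. -/
theorem exists_sub_mem_powerIdeal_of_forall_mul_mem {x : ι → R}
    (hx : ∀ (T : Finset ι), ∀ i ∉ T, ∀ r, x i * r ∈ Ideal.span (x '' T) → r ∈ Ideal.span (x '' T))
    (t : ℕ) {r : R} (hr : ∀ i, x i * r ∈ powerIdeal x (fun _ ↦ t + 1) univ) :
    ∃ c, r - c * (∏ i, x i) ^ t ∈ powerIdeal x (fun _ ↦ t + 1) univ := by
  have key (S : Finset ι) : ∀ r,
      (∀ i, x i * r ∈ powerIdeal x (fun j ↦ if j ∈ S then t + 1 else 1) univ) →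
      ∃ c, r - c * (∏ i ∈ S, x i) ^ t ∈
        powerIdeal x (fun j ↦ if j ∈ S then t + 1 else 1) univ := by
    induction S using Finset.induction_on with
    | empty => exact fun r _ ↦ ⟨r, by simp⟩
    | insert i S hi ih =>
      intro r hr
      -- `r` lies in the ideal with exponent `t` at `i`, so `r = s x_i ^ t` modulo the given ideal,
      -- and `s` is in the socle for the ideal with exponent `1` at `i`.
      have h1 : r ∈ powerIdeal x
          (Function.update (fun j ↦ if j ∈ insert i S then t + 1 else 1) i t) univ :=
        mem_powerIdeal_univ_of_pow_mul_mem hx i 1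
          (b := fun j ↦ if j ∈ insert i S then t + 1 else 1) (fun j hj ↦ by simp [hj]) (by simp)
          (by simpa using hr i)
      have hcongr : ∀ j ∈ univ.erase i,
          Function.update (fun j ↦ if j ∈ insert i S then t + 1 else 1) i t j =
            (fun j ↦ if j ∈ insert i S then t + 1 else 1) j := fun j hj ↦
        Function.update_of_ne (ne_of_mem_erase hj) _ _
      rw [← insert_erase (mem_univ i)] at h1
      obtain ⟨s, hs⟩ := (mem_powerIdeal_insert _ _).1 h1
      rw [Function.update_self, powerIdeal_congr x hcongr] at hs
      have hs' := powerIdeal_mono x _ (subset_univ (univ.erase i)) hs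
      obtain ⟨c, hc⟩ := ih s fun j ↦ by
        refine mem_powerIdeal_univ_of_pow_mul_mem hx i t
          (a := fun j ↦ if j ∈ S then t + 1 else 1)
          (b := fun j ↦ if j ∈ insert i S then t + 1 else 1) (fun j hj ↦ by simp [hj])
          (by simp [hi, add_comm]) ?_
        have := sub_mem (hr j) (Ideal.mul_mem_left _ (x j) hs')
        convert this using 1
        ring
      rw [← insert_erase (mem_univ i)] at hc
      obtain ⟨e, he⟩ := (mem_powerIdeal_insert _ _).1 hc
      refine ⟨c, ?_⟩
      have he' : s - c * (∏ i ∈ S, x i) ^ t - e * x i ∈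
          powerIdeal x (fun j ↦ if j ∈ insert i S then t + 1 else 1) (univ.erase i) := by
        rw [powerIdeal_congr x (b := fun j ↦ if j ∈ S then t + 1 else 1) fun j hj ↦ by
          simp [ne_of_mem_erase hj]]
        simpa [hi] using he
      have hpow : x i ^ (t + 1) ∈
          powerIdeal x (fun j ↦ if j ∈ insert i S then t + 1 else 1) univ := by
        simpa using pow_mem_powerIdeal x
          (fun j ↦ if j ∈ insert i S then t + 1 else 1) (mem_univ i)
      have := add_mem (add_mem hs' (Ideal.mul_mem_right (x i ^ t) _
        (powerIdeal_mono x _ (subset_univ _) he'))) (Ideal.mul_mem_left _ e hpow)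
      rw [prod_insert hi, mul_pow]
      convert this using 1
      ring
  simpa using key univ r (by simpa using hr)

end PowerIdeal

end Parasolid

/-! ### Modules with simple socle over a local ring -/

namespace Parasolid

open IsLocalRing

section Length

variable {R : Type*} [CommRing R]

theorem surjective_of_injective_of_length_le {M N : Type*} [AddCommGroup M] [Module R M]
    [AddCommGroup N] [Module R N] {f : M →ₗ[R] N} (hf : Function.Injective f)
    (hM : Module.length R M ≠ ⊤) (h : Module.length R N ≤ Module.length R M) :
    Function.Surjective f := by
  obtain ⟨_, _⟩ := isFiniteLength_iff_isNoetherian_isArtinian.1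
    (Module.length_ne_top_iff.1 (ne_top_of_le_ne_top hM h))
  rw [← LinearMap.range_eq_top]
  by_contra hne
  have h1 := Submodule.length_lt hne
  rw [← (LinearEquiv.ofInjective f hf).length_eq] at h1
  exact h1.not_ge h

open Module

variable {E : Type*} [AddCommGroup E] [Module R E]

theorem length_hom_eq_add {M : Type*} [AddCommGroup M] [Module R M] (N : Submodule R M) :
    length R (M →ₗ[R] E) = length R (M ⧸ N →ₗ[R] E) +
      length R (LinearMap.range (LinearMap.lcomp R E N.subtype)) := by
  refine length_eq_add_of_exact (LinearMap.lcomp R E N.mkQ)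
    (LinearMap.lcomp R E N.subtype).rangeRestrict ?_ (LinearMap.surjective_rangeRestrict _) ?_
  · intro f g h
    ext m
    exact LinearMap.congr_fun h m
  · intro f
    rw [← LinearMap.mem_ker, LinearMap.ker_rangeRestrict, LinearMap.mem_ker]
    constructor
    · intro h
      refine ⟨N.liftQ f fun n hn ↦ LinearMap.congr_fun h ⟨n, hn⟩, ?_⟩
      ext m
      rfl
    · rintro ⟨g, rfl⟩
      ext n
      have : N.mkQ n = 0 := (Submodule.Quotient.mk_eq_zero N).2 n.2
      change g (N.mkQ n) = 0
      rw [this, map_zero]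

theorem exists_injective_hom {I : Ideal R} {e : E} (he : ∀ r : R, r • e = 0 ↔ r ∈ I) :
    ∃ Φ : (R ⧸ I) →ₗ[R] (R ⧸ I) →ₗ[R] E, Function.Injective Φ ∧
      ∀ r : R, Φ (Submodule.Quotient.mk r) (Submodule.Quotient.mk 1) = r • e := by
  let f : (R ⧸ I) →ₗ[R] E :=
    Submodule.liftQ I (LinearMap.toSpanSingleton R E e) fun r hr ↦ (he r).2 hr
  have hf : Function.Injective f := by
    rw [← LinearMap.ker_eq_bot, LinearMap.ker_eq_bot']
    intro z hz
    obtain ⟨r, rfl⟩ := Submodule.Quotient.mk_surjective _ z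
    exact (Submodule.Quotient.mk_eq_zero I).2 ((he r).1 hz)
  refine ⟨(LinearMap.mul R (R ⧸ I)).compr₂ f, fun a b h ↦ hf ?_, fun r ↦ ?_⟩
  · have := LinearMap.congr_fun h 1
    simpa using this
  · change f (Submodule.Quotient.mk r * 1) = r • e
    rw [mul_one]
    rfl

theorem length_quotient_le_length_hom {I : Ideal R} {e : E}
    (he : ∀ r : R, r • e = 0 ↔ r ∈ I) :
    length R (R ⧸ I) ≤ length R ((R ⧸ I) →ₗ[R] E) :=
  have ⟨Φ, hΦ, _⟩ := exists_injective_hom he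
  length_le_of_injective Φ hΦ

variable [IsLocalRing R]

theorem isFiniteLength_quotient_of_pow_le [IsNoetherianRing R] {I : Ideal R} {n : ℕ}
    (h : maximalIdeal R ^ n ≤ I) : IsFiniteLength R (R ⧸ I) := by
  have : Ring.KrullDimLE 0 (R ⧸ I) := .mk₀ fun P hP ↦ by
    have hle : maximalIdeal R ≤ P.comap (Ideal.Quotient.mk I) := by
      refine (hP.comap (Ideal.Quotient.mk I)).le_of_pow_le (h.trans fun r hr ↦ ?_)
      rw [Ideal.mem_comap, Ideal.Quotient.eq_zero_iff_mem.2 hr]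
      exact zero_mem _
    have heq := le_antisymm (le_maximalIdeal (hP.comap (Ideal.Quotient.mk I)).ne_top) hle
    have hmax : (P.comap (Ideal.Quotient.mk I)).IsMaximal := heq ▸ maximalIdeal.isMaximal R
    exact Ideal.isMaximal_of_isIntegral_of_isMaximal_comap P hmax
  have : IsArtinianRing (R ⧸ I) := isArtinianRing_iff_isNoetherianRing_krullDimLE_zero.2
    ⟨inferInstance, this⟩
  rw [isFiniteLength_iff_isNoetherian_isArtinian]
  exact ⟨inferInstance,
    isArtinian_of_surjective_algebraMap (R := R ⧸ I) Ideal.Quotient.mk_surjective⟩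

/-- `u` generates the socle `{z | 𝔪 z = 0}` of `E`. As `u = 0` is allowed, this says that the socle
has length at most one. -/
structure IsSocleGenerator (u : E) : Prop where
  smul_eq_zero : ∀ r ∈ maximalIdeal R, r • u = 0
  mem_span : ∀ z : E, (∀ r ∈ maximalIdeal R, r • z = 0) → z ∈ Submodule.span R {u}

theorem IsSocleGenerator.length_span_le {u : E} (hu : IsSocleGenerator (R := R) u) :
    length R (Submodule.span R {u}) ≤ 1 := by
  have h1 : length R (R ⧸ maximalIdeal R) = 1 := by
    rw [length_eq_one_iff]
    exact isSimpleModule_iff_isCoatom.2 (maximalIdeal.isMaximal R).out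
  rw [← h1, ← LinearMap.range_toSpanSingleton]
  let f := (maximalIdeal R).liftQ (LinearMap.toSpanSingleton R E u) hu.smul_eq_zero
  have : LinearMap.range (LinearMap.toSpanSingleton R E u) = LinearMap.range f :=
    (Submodule.range_liftQ _ _ _).symm
  rw [this]
  exact length_le_of_surjective f.rangeRestrict f.surjective_rangeRestrict

/-- For `M` simple, `Hom(M, E)` embeds into the socle of `E`; the general case follows by
dévissage. -/
theorem IsSocleGenerator.length_hom_le {u : E} (hu : IsSocleGenerator (R := R) u)
    {M : Type*} [AddCommGroup M] [Module R M] (hM : IsFiniteLength R M) :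
    length R (M →ₗ[R] E) ≤ length R M := by
  induction hM with
  | @of_subsingleton M _ _ _ =>
    have : Subsingleton (M →ₗ[R] E) := ⟨fun f g ↦ by ext m; simp [Subsingleton.elim m 0]⟩
    simp [length_eq_zero]
  | @of_simple_quotient M _ _ N _ _ ih =>
    rw [length_hom_eq_add N, length_eq_add_of_exact N.subtype N.mkQ N.subtype_injective
      N.mkQ_surjective (LinearMap.exact_subtype_mkQ N), add_comm]
    refine add_le_add ((length_le_of_injective _ (Submodule.subtype_injective _)).trans ih) ?_
    rw [length_eq_one R (M ⧸ N)]
    have hann : annihilator R (M ⧸ N) = maximalIdeal R :=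
      eq_maximalIdeal (IsSimpleModule.annihilator_isMaximal (R := R) (M := M ⧸ N))
    have := IsSimpleModule.nontrivial R (M ⧸ N)
    obtain ⟨v, hv⟩ := exists_ne (0 : M ⧸ N)
    let f : (M ⧸ N →ₗ[R] E) →ₗ[R] Submodule.span R {u} :=
      (LinearMap.applyₗ v).codRestrict _ fun g ↦ hu.mem_span _ fun r hr ↦ by
        rw [LinearMap.applyₗ_apply_apply, ← map_smul, mem_annihilator.1 (hann.symm ▸ hr), map_zero]
    refine (length_le_of_injective f fun g g' h ↦ ?_).trans hu.length_span_le
    refine LinearMap.ext_on_range (v := fun _ : Unit ↦ v) ?_ fun _ ↦ congrArg Subtype.val h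
    rw [Set.range_const]
    exact IsSimpleModule.span_singleton_eq_top R hv

/-- If `Hom(M, E)` is as long as possible, then all maps from submodules of `M` to `E` extend to
`M`. -/
theorem IsSocleGenerator.exists_extension {u : E} (hu : IsSocleGenerator (R := R) u)
    {M : Type*} [AddCommGroup M] [Module R M] (hM : IsFiniteLength R M)
    (hlen : length R M ≤ length R (M →ₗ[R] E)) (N : Submodule R M) (g : N →ₗ[R] E) :
    ∃ h : M →ₗ[R] E, h ∘ₗ N.subtype = g := by
  have hM' := length_ne_top_iff.2 hM
  have hQ := length_ne_top_iff.2 (hM.of_surjective N.mkQ_surjective)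
  have hN := hM.of_injective N.subtype_injective
  have h1 : length R N ≤ length R (LinearMap.range (LinearMap.lcomp R E N.subtype)) := by
    rw [length_hom_eq_add N, length_eq_add_of_exact N.subtype N.mkQ N.subtype_injective
      N.mkQ_surjective (LinearMap.exact_subtype_mkQ N), add_comm] at hlen
    have h2 := hu.length_hom_le (hM.of_surjective N.mkQ_surjective)
    exact (ENat.add_le_add_iff_left hQ).1 (hlen.trans (add_le_add_left h2 _))
  have h3 := hu.length_hom_le hN
  obtain ⟨⟨_, h, rfl⟩, hh⟩ := surjective_of_injective_of_length_le
    (f := (LinearMap.range (LinearMap.lcomp R E N.subtype)).subtype)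
    (Submodule.subtype_injective _)
    (ne_top_of_le_ne_top (length_ne_top_iff.2 hN)
      ((length_le_of_injective _ (Submodule.subtype_injective _)).trans h3))
    (h3.trans h1) g
  exact ⟨h, hh⟩

theorem IsSocleGenerator.exists_eq_smul {u : E} (hu : IsSocleGenerator (R := R) u)
    {I : Ideal R} {e : E} (he : ∀ r : R, r • e = 0 ↔ r ∈ I)
    (hI : IsFiniteLength R (R ⧸ I)) {z : E} (hz : ∀ r ∈ I, r • z = 0) : ∃ r : R, z = r • e := by
  obtain ⟨Φ, hΦ, hΦe⟩ := exists_injective_hom he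
  obtain ⟨a, ha⟩ := surjective_of_injective_of_length_le hΦ (length_ne_top_iff.2 hI)
    (hu.length_hom_le hI) (Submodule.liftQ I (LinearMap.toSpanSingleton R E z) hz)
  obtain ⟨r, rfl⟩ := Submodule.Quotient.mk_surjective _ a
  refine ⟨r, ?_⟩
  rw [← hΦe, ha]
  exact (one_smul R z).symm

end Length

section Baer

variable {R : Type*} [CommRing R] [IsLocalRing R] [IsNoetherianRing R]
  {E : Type*} [AddCommGroup E] [Module R E]

/-- Let `I t` be a decreasing sequence of ideals defining the `𝔪`-adic topology. A module with
simple socle that is the union of cyclic submodules `R ⧸ I t` is injective: by the Artin–Rees lemma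
a map `J → E` factors through the image of `J` in some `R ⧸ I t`, where a comparison of lengths
yields an extension. -/
theorem IsSocleGenerator.baer {u : E} (hu : IsSocleGenerator (R := R) u) {I : ℕ → Ideal R}
    (hanti : Antitone I) (hle : ∀ t, I t ≤ maximalIdeal R ^ t)
    (hpow : ∀ t, ∃ n, maximalIdeal R ^ n ≤ I t) {e : ℕ → E}
    (he : ∀ t, ∀ r : R, r • e t = 0 ↔ r ∈ I t) (hex : ∀ z : E, ∃ t, ∃ r : R, z = r • e t) :
    Module.Baer R E := by
  intro J g
  have hkill (z : E) : ∃ t, ∀ r ∈ I t, r • z = 0 := by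
    obtain ⟨t, c, rfl⟩ := hex z
    exact ⟨t, fun r hr ↦ by rw [smul_comm, (he t r).2 hr, smul_zero]⟩
  obtain ⟨s, hs⟩ : ∃ s, ∀ j, ∀ r ∈ I s, r • g j = 0 := by
    obtain ⟨S, hS⟩ := (IsNoetherian.noetherian (⊤ : Submodule R J))
    choose t ht using hkill
    refine ⟨S.sup fun j ↦ t (g j), fun j ↦ ?_⟩
    have hj : j ∈ Submodule.span R (S : Set J) := hS ▸ Submodule.mem_top
    induction hj using Submodule.span_induction with
    | mem j hj => exact fun r hr ↦ ht _ r (hanti (Finset.le_sup (f := fun j ↦ t (g j)) hj) hr)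
    | zero => simp
    | add a b _ _ ha hb => exact fun r hr ↦ by rw [map_add, smul_add, ha r hr, hb r hr, add_zero]
    | smul c a _ ha => exact fun r hr ↦ by rw [map_smul, smul_comm, ha r hr, smul_zero]
  obtain ⟨k, hk⟩ := Ideal.exists_pow_inf_eq_pow_smul (I s) (J : Submodule R R)
  obtain ⟨p, hp⟩ := hpow s
  have hJ (j : R) (hjJ : j ∈ J) (hj : j ∈ I (p * (k + 1))) : g ⟨j, hjJ⟩ = 0 := by
    have h1 : j ∈ I s ^ (k + 1) • (⊤ : Submodule R R) ⊓ J := by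
      refine ⟨?_, hjJ⟩
      rw [smul_eq_mul, Ideal.mul_top]
      refine Ideal.pow_right_mono hp (k + 1) ?_
      rw [← pow_mul]
      exact hle _ hj
    rw [hk (k + 1) (by lia), Nat.add_sub_cancel_left, pow_one] at h1
    obtain ⟨_, h⟩ : ∃ h : j ∈ J, g ⟨j, h⟩ = 0 := by
      clear hjJ hj
      induction h1 using Submodule.smul_induction_on' with
      | smul r hr n hn =>
        exact ⟨J.mul_mem_left r hn.2, (map_smul g r ⟨n, hn.2⟩).trans (hs _ r hr)⟩
      | add a _ b _ ha hb =>
        obtain ⟨⟨ha, ha'⟩, hb, hb'⟩ := ha, hb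
        exact ⟨add_mem ha hb, (map_add g ⟨a, ha⟩ ⟨b, hb⟩).trans (by rw [ha', hb', add_zero])⟩
    exact h
  set t := p * (k + 1)
  obtain ⟨n, hn⟩ := hpow t
  have hfin := isFiniteLength_quotient_of_pow_le hn
  let π : J →ₗ[R] Submodule.map (I t).mkQ J := (I t).mkQ.submoduleMap J
  have hπ : Function.Surjective π := LinearMap.submoduleMap_surjective _ _
  have hker : LinearMap.ker π ≤ LinearMap.ker g := fun j hj ↦
    hJ j j.2 ((Submodule.Quotient.mk_eq_zero (I t)).1 (congrArg Subtype.val hj))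
  obtain ⟨h, hh⟩ := hu.exists_extension hfin (length_quotient_le_length_hom (he t))
    (Submodule.map (I t).mkQ J)
    ((LinearMap.ker π).liftQ g hker ∘ₗ (π.quotKerEquivOfSurjective hπ).symm.toLinearMap)
  refine ⟨h ∘ₗ (I t).mkQ, fun r hr ↦ ?_⟩
  have := LinearMap.congr_fun hh (π ⟨r, hr⟩)
  refine this.trans ?_
  have hsymm : (π.quotKerEquivOfSurjective hπ).symm (π ⟨r, hr⟩) =
      Submodule.Quotient.mk ⟨r, hr⟩ := by
    rw [LinearEquiv.symm_apply_eq]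
    rfl
  rw [LinearMap.comp_apply, LinearEquiv.coe_coe, hsymm, Submodule.liftQ_apply]

end Baer

end Parasolid

noncomputable section

/-! ### Fractions in top Čech cohomology -/

namespace Parasolid

section Cech

variable {R : Type*} [CommRing R]

theorem smul_pow_injective (b : R) (n : ℕ) (M : Type*) [AddCommGroup M] [Module R M] :
    Function.Injective fun z : LocalizedModule (Submonoid.powers b) M ↦ b ^ n • z :=
  IsLocalizedModule.smul_injective (LocalizedModule.mkLinearMap (Submonoid.powers b) M)
    (⟨b ^ n, n, rfl⟩ : Submonoid.powers b)

/-- The map `m ↦ m / b ^ n` from `M` to `M_b`. -/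
def divPow (b : R) (n : ℕ) (M : Type*) [AddCommGroup M] [Module R M] :
    M →ₗ[R] LocalizedModule (Submonoid.powers b) M :=
  LocalizedModule.divBy (⟨b ^ n, n, rfl⟩ : Submonoid.powers b) ∘ₗ
    LocalizedModule.mkLinearMap (Submonoid.powers b) M

theorem divPow_apply (b : R) (n : ℕ) {M : Type*} [AddCommGroup M] [Module R M] (m : M) :
    divPow b n M m = LocalizedModule.mk m (⟨b ^ n, n, rfl⟩ : Submonoid.powers b) := by
  rw [divPow, LinearMap.comp_apply, LocalizedModule.mkLinearMap_apply,
    LocalizedModule.divBy_apply, LocalizedModule.liftOn_mk, one_mul]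

theorem exists_eq_divPow (b : R) {M : Type*} [AddCommGroup M] [Module R M]
    (z : LocalizedModule (Submonoid.powers b) M) : ∃ n m, z = divPow b n M m := by
  induction z using LocalizedModule.induction_on with
  | h m s =>
    obtain ⟨_, n, rfl⟩ := s
    exact ⟨n, m, (divPow_apply b n m).symm⟩

theorem pow_smul_divPow (b : R) (n : ℕ) {M : Type*} [AddCommGroup M] [Module R M] (m : M) :
    b ^ n • divPow b n M m = LocalizedModule.mkLinearMap (Submonoid.powers b) M m := by
  rw [divPow_apply, LocalizedModule.smul'_mk]
  exact LocalizedModule.mk_cancel (⟨b ^ n, n, rfl⟩ : Submonoid.powers b) m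

theorem pow_smul_divPow_add (b : R) (t k : ℕ) {M : Type*} [AddCommGroup M] [Module R M] (m : M) :
    b ^ k • divPow b (t + k) M m = divPow b t M m := by
  apply smul_pow_injective b t M
  dsimp only
  rw [← mul_smul, ← pow_add, pow_smul_divPow, pow_smul_divPow]

theorem awayMap_mkLinearMap {M : Type*} [AddCommGroup M] [Module R M] {a b : R} (h : a ∣ b)
    (m : M) : awayMap M h (LocalizedModule.mkLinearMap (Submonoid.powers a) M m) =
      LocalizedModule.mkLinearMap (Submonoid.powers b) M m :=
  LinearMap.congr_fun (LocalizedModule.lift_comp (Submonoid.powers a)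
    (LocalizedModule.mkLinearMap (Submonoid.powers b) M) (isUnit_end_of_dvd M h)) m

theorem awayMap_divPow {M : Type*} [AddCommGroup M] [Module R M] {a b c : R} (h : a ∣ b)
    (hc : c * a = b) (n : ℕ) (m : M) :
    awayMap M h (divPow a n M m) = divPow b n M (c ^ n • m) := by
  subst hc
  apply smul_pow_injective (c * a) n M
  dsimp only
  rw [pow_smul_divPow, mul_pow, mul_smul, ← map_smul (awayMap M h), pow_smul_divPow,
    awayMap_mkLinearMap, map_smul]

theorem localizedMap_divPow {M N : Type*} [AddCommGroup M] [Module R M] [AddCommGroup N]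
    [Module R N] (b : R) (f : M →ₗ[R] N) (n : ℕ) (m : M) :
    localizedMap b f (divPow b n M m) = divPow b n N (f m) := by
  apply smul_pow_injective b n N
  dsimp only
  rw [pow_smul_divPow, ← map_smul (localizedMap b f), pow_smul_divPow, localizedMap,
    IsLocalizedModule.map_apply]

variable {d : ℕ} (x : Fin d → R)

/-- The map `m ↦ m / (x_1 ⋯ x_d) ^ t` from `M` to `H^d(x_1, …, x_d; M)`. -/
def cechClass (M : Type*) [AddCommGroup M] [Module R M] (t : ℕ) : M →ₗ[R] TopCohomology x M :=
  (LinearMap.range (cechDifferential x M)).mkQ ∘ₗ divPow (∏ j, x j) t M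

variable {M : Type*} [AddCommGroup M] [Module R M]

theorem paraclass_eq : paraclass x = cechClass x R 1 1 := by
  have : (⟨∏ j, x j, Submonoid.mem_powers _⟩ : Submonoid.powers (∏ j, x j)) =
      ⟨(∏ j, x j) ^ 1, 1, rfl⟩ := Subtype.ext (pow_one _).symm
  rw [paraclass, this, ← divPow_apply]
  rfl

theorem exists_eq_cechClass (z : TopCohomology x M) : ∃ t m, z = cechClass x M t m := by
  obtain ⟨z, rfl⟩ := Submodule.Quotient.mk_surjective _ z
  obtain ⟨t, m, rfl⟩ := exists_eq_divPow _ z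
  exact ⟨t, m, rfl⟩

theorem pow_smul_cechClass_add (t k : ℕ) (m : M) :
    (∏ j, x j) ^ k • cechClass x M (t + k) m = cechClass x M t m :=
  congrArg Submodule.Quotient.mk (pow_smul_divPow_add _ t k m)

theorem topCohomologyMap_cechClass {N : Type*} [AddCommGroup N] [Module R N] (f : M →ₗ[R] N)
    (t : ℕ) (m : M) : topCohomologyMap x f (cechClass x M t m) = cechClass x N t (f m) :=
  congrArg Submodule.Quotient.mk (localizedMap_divPow _ f t m)

open Finset

theorem smul_cechClass_eq_zero {t : ℕ} {r : R} (hr : r ∈ powerIdeal x (fun _ ↦ t) univ) (m : M) :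
    r • cechClass x M t m = 0 := by
  suffices powerIdeal x (fun _ ↦ t) univ ≤
      LinearMap.ker (LinearMap.toSpanSingleton R _ (cechClass x M t m)) from this hr
  refine Ideal.span_le.2 ?_
  rintro _ ⟨i, -, rfl⟩
  change x i ^ t • cechClass x M t m = 0
  rw [← map_smul]
  refine (Submodule.Quotient.mk_eq_zero _).2 ⟨Pi.single i ((-1 : R) ^ (i : ℕ) •
    divPow (∏ j ∈ univ.erase i, x j) t M m), ?_⟩
  rw [cechDifferential, LinearMap.sum_apply, sum_eq_single i]
  · simp only [LinearMap.smul_apply, LinearMap.comp_apply, LinearMap.proj_apply, Pi.single_eq_same,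
      map_smul, smul_smul]
    rw [← mul_pow, neg_one_mul, neg_neg, one_pow, one_smul,
      awayMap_divPow _ (mul_prod_erase univ x (mem_univ i))]
    exact map_smul _ _ _
  · intro j _ hj
    simp [Pi.single_eq_of_ne hj]
  · simp

theorem prod_pow_mul_mem_powerIdeal {s : ℕ} (k : ℕ) {r : R}
    (hr : r ∈ powerIdeal x (fun _ ↦ s) univ) :
    (∏ j, x j) ^ k * r ∈ powerIdeal x (fun _ ↦ s + k) univ := by
  induction hr using Submodule.span_induction with
  | mem r hr =>
    obtain ⟨i, -, rfl⟩ := hr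
    rw [← mul_prod_erase univ x (mem_univ i)]
    convert Ideal.mul_mem_left _ ((∏ j ∈ univ.erase i, x j) ^ k)
      (pow_mem_powerIdeal x (fun _ ↦ s + k) (mem_univ i)) using 1
    ring
  | zero => simp
  | add a b _ _ ha hb => rw [mul_add]; exact add_mem ha hb
  | smul c a _ ha => rw [smul_eq_mul, mul_left_comm]; exact Ideal.mul_mem_left _ c ha

/-- The submodule of those fractions in `R_{x_1 ⋯ x_d}` that can be written as
`r / (x_1 ⋯ x_d) ^ s` with `r ∈ (x_1 ^ s, …, x_d ^ s)`. -/
def boundaryFractions : Submodule R (CechTop x R) where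
  carrier := {w | ∃ s, ∃ r ∈ powerIdeal x (fun _ ↦ s) univ, w = divPow (∏ j, x j) s R r}
  zero_mem' := ⟨0, 0, zero_mem _, (map_zero _).symm⟩
  add_mem' := by
    rintro _ _ ⟨s, r, hr, rfl⟩ ⟨s', r', hr', rfl⟩
    refine ⟨s + s', (∏ j, x j) ^ s' * r + (∏ j, x j) ^ s * r',
      add_mem (prod_pow_mul_mem_powerIdeal x s' hr) ?_, ?_⟩
    · rw [add_comm]
      exact prod_pow_mul_mem_powerIdeal x s hr'
    · rw [map_add, ← smul_eq_mul, ← smul_eq_mul, map_smul, map_smul, pow_smul_divPow_add,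
        add_comm s, pow_smul_divPow_add]
  smul_mem' := by
    rintro c _ ⟨s, r, hr, rfl⟩
    exact ⟨s, c • r, Ideal.mul_mem_left _ c hr, (map_smul _ _ _).symm⟩

theorem range_cechDifferential_le_boundaryFractions :
    LinearMap.range (cechDifferential x R) ≤ boundaryFractions x := by
  rintro _ ⟨z, rfl⟩
  rw [cechDifferential, LinearMap.sum_apply]
  refine sum_mem fun i _ ↦ Submodule.smul_mem _ _ ?_
  rw [LinearMap.comp_apply, LinearMap.proj_apply]
  obtain ⟨s, m, hm⟩ := exists_eq_divPow _ (z i)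
  rw [hm, awayMap_divPow _ (mul_prod_erase univ x (mem_univ i))]
  exact ⟨s, _, Ideal.mul_mem_right _ _ (pow_mem_powerIdeal x (fun _ ↦ s) (mem_univ i)), rfl⟩

variable {x} in
/-- The fraction `r / (x_1 ⋯ x_d) ^ t` vanishes in `H^d(x_1, …, x_d; R)` only if
`r ∈ (x_1 ^ t, …, x_d ^ t)`. -/
theorem smul_cechClass_eq_zero_iff
    (hx : ∀ (T : Finset (Fin d)), ∀ i ∉ T, ∀ r,
      x i * r ∈ Ideal.span (x '' T) → r ∈ Ideal.span (x '' T)) (t : ℕ) (r : R) :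
    r • cechClass x R t 1 = 0 ↔ r ∈ powerIdeal x (fun _ ↦ t) univ := by
  refine ⟨fun h ↦ ?_, fun h ↦ smul_cechClass_eq_zero x h 1⟩
  rw [← map_smul, smul_eq_mul, mul_one] at h
  obtain ⟨s, r', hr', h⟩ := range_cechDifferential_le_boundaryFractions x
    ((Submodule.Quotient.mk_eq_zero _).1 h)
  rw [divPow_apply, divPow_apply] at h
  obtain ⟨⟨_, N, rfl⟩, hN⟩ := LocalizedModule.mk_eq.1 h
  change (∏ j, x j) ^ N * ((∏ j, x j) ^ s * r) = (∏ j, x j) ^ N * ((∏ j, x j) ^ t * r') at hN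
  refine mem_powerIdeal_of_prod_pow_mul_mem hx t (N + s) ?_
  rw [pow_add, mul_assoc, hN, ← mul_assoc, ← pow_add]
  convert prod_pow_mul_mem_powerIdeal x (N + t) hr' using 3
  ring

end Cech

end Parasolid

end

noncomputable section

/-! ### Injectivity of the top local cohomology of a regular local ring -/

namespace Parasolid

open IsLocalRing

section Essential

variable {R : Type*} [CommRing R] [IsLocalRing R] {E F : Type*} [AddCommGroup E] [Module R E]
  [AddCommGroup F] [Module R F]

/-- A module all of whose elements are killed by powers of `𝔪` is an essential extension of its
socle. -/
theorem IsSocleGenerator.injective {u : E} (hu : IsSocleGenerator (R := R) u)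
    (htors : ∀ z : E, ∃ n, ∀ r ∈ maximalIdeal R ^ n, r • z = 0) {f : E →ₗ[R] F} (hf : f u ≠ 0) :
    Function.Injective f := by
  rw [← LinearMap.ker_eq_bot, LinearMap.ker_eq_bot']
  intro z hz
  by_contra hne
  classical
  obtain ⟨k, hk⟩ : ∃ k, Nat.find (htors z) = k + 1 := Nat.exists_eq_succ_of_ne_zero fun h ↦ by
    have := Nat.find_spec (htors z) 1 (by simp [h])
    exact hne (by simpa using this)
  have hlast := Nat.find_spec (htors z)
  rw [hk] at hlast
  have hmin := Nat.find_min (htors z) (m := k) (by lia)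
  push Not at hmin
  obtain ⟨r, hr, hrz⟩ := hmin
  obtain ⟨c, hc⟩ := Submodule.mem_span_singleton.1 (hu.mem_span (r • z) fun s hs ↦ by
    rw [smul_smul]
    exact hlast _ (by rw [pow_succ']; exact Ideal.mul_mem_mul hs hr))
  have hcu : IsUnit c := by
    by_contra h
    exact hrz (hc ▸ hu.smul_eq_zero c ((mem_maximalIdeal c).2 h))
  apply hf
  rw [← hcu.smul_eq_zero, ← map_smul, hc, map_smul, hz, smul_zero]

end Essential

section Regular

open Finset

variable {R : Type*} [CommRing R]

theorem antitone_powerIdeal {ι : Type*} (x : ι → R) (T : Finset ι) :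
    Antitone fun t ↦ powerIdeal x (fun _ ↦ t) T := by
  intro s t hst
  refine Ideal.span_le.2 ?_
  rintro _ ⟨i, hi, rfl⟩
  exact Ideal.mem_of_dvd _ (pow_dvd_pow _ hst) (pow_mem_powerIdeal x (fun _ ↦ s) hi)

theorem exists_eq_smul_cechClass_one {d : ℕ} {x : Fin d → R}
    (z : TopCohomology x R) :
    ∃ t, ∃ r : R, z = r • cechClass x R t 1 := by
  obtain ⟨t, m, rfl⟩ := exists_eq_cechClass x z
  exact ⟨t, m, by rw [← map_smul, smul_eq_mul, mul_one]⟩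

variable [IsLocalRing R] {d : ℕ} {x : Fin d → R}
  (hx : Ideal.span (Set.range x) = maximalIdeal R)

include hx

theorem powerIdeal_le_pow (t : ℕ) : powerIdeal x (fun _ ↦ t) univ ≤ maximalIdeal R ^ t := by
  refine Ideal.span_le.2 ?_
  rintro _ ⟨i, -, rfl⟩
  exact Ideal.pow_mem_pow (hx ▸ Ideal.subset_span ⟨i, rfl⟩) t

theorem powerIdeal_one : powerIdeal x (fun _ ↦ 1) univ = maximalIdeal R := by
  simp [powerIdeal, hx]

theorem exists_pow_le_powerIdeal [IsNoetherianRing R] (t : ℕ) :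
    ∃ n, maximalIdeal R ^ n ≤ powerIdeal x (fun _ ↦ t) univ := by
  refine Ideal.exists_pow_le_of_le_radical_of_fg ?_ (IsNoetherian.noetherian _)
  rw [← hx, Ideal.span_le]
  rintro _ ⟨i, rfl⟩
  exact ⟨t, pow_mem_powerIdeal x (fun _ ↦ t) (mem_univ i)⟩

theorem exists_pow_smul_eq_zero [IsNoetherianRing R] (z : TopCohomology x R) :
    ∃ n, ∀ r ∈ maximalIdeal R ^ n, r • z = 0 := by
  obtain ⟨t, m, rfl⟩ := exists_eq_cechClass x z
  obtain ⟨n, hn⟩ := exists_pow_le_powerIdeal hx t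
  exact ⟨n, fun r hr ↦ smul_cechClass_eq_zero x (hn hr) m⟩

variable (hreg : ∀ (T : Finset (Fin d)), ∀ i ∉ T, ∀ r,
  x i * r ∈ Ideal.span (x '' T) → r ∈ Ideal.span (x '' T))

include hreg

/-- The paraclass of a regular system of parameters generates the socle of `H^d_𝔪(R)`. -/
theorem isSocleGenerator_paraclass : IsSocleGenerator (R := R) (paraclass x) where
  smul_eq_zero r hr := by
    rw [paraclass_eq]
    exact smul_cechClass_eq_zero x (powerIdeal_one hx ▸ hr) 1
  mem_span z hz := by
    obtain ⟨t, m, rfl⟩ := exists_eq_cechClass x z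
    rw [← pow_smul_cechClass_add x t 1, ← map_smul] at hz ⊢
    generalize (∏ j, x j) ^ 1 • m = r at hz ⊢
    have hr : cechClass x R (t + 1) r = r • cechClass x R (t + 1) 1 := by
      rw [← map_smul, smul_eq_mul, mul_one]
    rw [hr] at hz ⊢
    obtain ⟨c, hc⟩ := exists_sub_mem_powerIdeal_of_forall_mul_mem hreg t fun i ↦ by
      rw [← smul_cechClass_eq_zero_iff hreg, mul_smul]
      exact hz _ (hx ▸ Ideal.subset_span ⟨i, rfl⟩)
    have h := smul_cechClass_eq_zero x hc (1 : R)
    rw [sub_smul, sub_eq_zero, mul_smul, add_comm t, pow_smul_cechClass_add, ← paraclass_eq] at h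
    rw [add_comm t, h]
    exact Submodule.smul_mem _ _ (Submodule.mem_span_singleton_self _)

theorem paraclass_ne_zero : paraclass x ≠ 0 := by
  rw [paraclass_eq, ← one_smul R (cechClass x R 1 1), Ne, smul_cechClass_eq_zero_iff hreg,
    powerIdeal_one hx]
  exact fun h ↦ Ideal.IsPrime.ne_top' ((Ideal.eq_top_iff_one _).2 h)

variable [IsNoetherianRing R]

theorem baer_topCohomology : Module.Baer R (TopCohomology x R) :=
  (isSocleGenerator_paraclass hx hreg).baer (antitone_powerIdeal x univ) (powerIdeal_le_pow hx)
    (exists_pow_le_powerIdeal hx) (smul_cechClass_eq_zero_iff hreg) exists_eq_smul_cechClass_one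

/-- The submodule of `H^d_𝔪(R)` killed by `(x_i ^ t)` is generated by `1 / (x_1 ⋯ x_d) ^ t`. -/
theorem exists_eq_smul_cechClass_of_forall {t : ℕ} {z : TopCohomology x R}
    (hz : ∀ r ∈ powerIdeal x (fun _ ↦ t) univ, r • z = 0) :
    ∃ r : R, z = r • cechClass x R t 1 :=
  have ⟨_, hn⟩ := exists_pow_le_powerIdeal hx t
  (isSocleGenerator_paraclass hx hreg).exists_eq_smul (smul_cechClass_eq_zero_iff hreg t)
    (isFiniteLength_quotient_of_pow_le hn) hz

/-- Matlis duality for `R` complete: a retraction `ψ` of `H^d_𝔪(R) → H^d_𝔪(M)` induced by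
`f : R → M` yields a retraction of `f`, since `ψ (m / (x_1 ⋯ x_d) ^ t)` is a multiple of
`1 / (x_1 ⋯ x_d) ^ t` by an element of `R ⧸ (x_i ^ t)`, compatibly in `t`. -/
theorem exists_retraction [IsAdicComplete (maximalIdeal R) R] {M : Type*} [AddCommGroup M]
    [Module R M] {f : R →ₗ[R] M} {ψ : TopCohomology x M →ₗ[R] TopCohomology x R}
    (hψ : ∀ z, ψ (topCohomologyMap x f z) = z) : ∃ L : M →ₗ[R] R, L (f 1) = 1 := by
  have hex (t : ℕ) (m : M) : ∃ r : R, ψ (cechClass x M t m) = r • cechClass x R t 1 :=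
    exists_eq_smul_cechClass_of_forall hx hreg fun r hr ↦ by
      rw [← map_smul, smul_cechClass_eq_zero x hr, map_zero]
  choose c hc using hex
  have huniq (t : ℕ) {a b : R} (h : a • cechClass x R t 1 = b • cechClass x R t 1) :
      (Submodule.Quotient.mk a : R ⧸ (maximalIdeal R ^ t • ⊤ : Submodule R R)) =
        Submodule.Quotient.mk b := by
    rw [Submodule.Quotient.eq, smul_eq_mul, Ideal.mul_top]
    refine powerIdeal_le_pow hx t ((smul_cechClass_eq_zero_iff hreg t _).1 ?_)
    rw [sub_smul, h, sub_self]
  let φ (t : ℕ) : M →ₗ[R] R ⧸ (maximalIdeal R ^ t • ⊤ : Submodule R R) :=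
    { toFun m := Submodule.Quotient.mk (c t m)
      map_add' m m' := by
        rw [← Submodule.Quotient.mk_add]
        exact huniq t (by rw [add_smul, ← hc, ← hc, ← hc, map_add, map_add])
      map_smul' r m := by
        rw [RingHom.id_apply, ← Submodule.Quotient.mk_smul]
        exact huniq t (by rw [smul_assoc, ← hc, ← hc, map_smul, map_smul]) }
  have hφ {s t : ℕ} (hst : s ≤ t) :
      Submodule.factorPow (maximalIdeal R) R hst ∘ₗ φ t = φ s := by
    ext m
    change (Submodule.Quotient.mk (c t m) : R ⧸ (maximalIdeal R ^ s • ⊤ : Submodule R R)) =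
      Submodule.Quotient.mk (c s m)
    obtain ⟨k, rfl⟩ := Nat.exists_eq_add_of_le hst
    refine huniq s ?_
    rw [← hc s, ← pow_smul_cechClass_add x s k (1 : R), smul_comm, ← hc, ← map_smul,
      pow_smul_cechClass_add]
  refine ⟨IsAdicComplete.lift (maximalIdeal R) φ hφ, ?_⟩
  rw [IsHausdorff.eq_iff_smodEq (I := maximalIdeal R)]
  intro t
  rw [SModEq, IsAdicComplete.mk_lift]
  refine huniq t ?_
  rw [← hc, ← topCohomologyMap_cechClass, hψ, one_smul]

end Regular

theorem topCohomologyMap_comp_apply {R : Type*} [CommRing R] {d : ℕ} (x : Fin d → R)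
    {L M N : Type*} [AddCommGroup L] [Module R L] [AddCommGroup M] [Module R M]
    [AddCommGroup N] [Module R N] (g : M →ₗ[R] N) (f : L →ₗ[R] M) (z : TopCohomology x L) :
    topCohomologyMap x g (topCohomologyMap x f z) = topCohomologyMap x (g ∘ₗ f) z := by
  obtain ⟨t, m, rfl⟩ := exists_eq_cechClass x z
  simp only [topCohomologyMap_cechClass, LinearMap.comp_apply]

/-! ### Splittings of the structure map -/

theorem isDirectSummand_iff {R A : Type*} [CommRing R] [CommRing A] [Algebra R A] :
    IsDirectSummand R A ↔ ∃ L : A →ₗ[R] R, L 1 = 1 := by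
  constructor
  · rintro ⟨hinj, V, hV⟩
    have hinj' : Function.Injective (Algebra.linearMap R A) := hinj
    refine ⟨(LinearEquiv.ofInjective _ hinj').symm.toLinearMap ∘ₗ
      Submodule.projectionOnto _ _ hV, ?_⟩
    have h1 : (1 : A) = (LinearEquiv.ofInjective _ hinj' 1 : A) := by simp
    rw [LinearMap.comp_apply, h1, Submodule.projectionOnto_apply_left, LinearEquiv.coe_coe,
      LinearEquiv.symm_apply_apply]
  · rintro ⟨L, hL⟩
    have hLR (r : R) : L (algebraMap R A r) = r := by
      rw [Algebra.algebraMap_eq_smul_one, map_smul, hL, smul_eq_mul, mul_one]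
    refine ⟨Function.LeftInverse.injective hLR, LinearMap.ker L, ?_⟩
    constructor
    · rw [Submodule.disjoint_def]
      rintro _ ⟨r, rfl⟩ hr
      have : r = 0 := (hLR r).symm.trans hr
      rw [this, map_zero]
    · rw [codisjoint_iff, eq_top_iff]
      intro a _
      refine Submodule.mem_sup.2 ⟨algebraMap R A (L a), ⟨L a, rfl⟩, a - algebraMap R A (L a), ?_,
        by abel⟩
      rw [LinearMap.mem_ker, map_sub, hLR, sub_self]

end Parasolid

end

theorem mainTheorem2 {R : Type*} [CommRing R] [IsRegularLocalRing R]
    [IsAdicComplete (IsLocalRing.maximalIdeal R) R]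
    {A : Type*} [CommRing A] [Algebra R A] :
    Parasolid.IsParasolid R A ↔ Parasolid.IsDirectSummand R A := by
  rw [Parasolid.isDirectSummand_iff]
  constructor
  · intro h
    obtain ⟨d, hd⟩ := IsLocalRing.exists_ringKrullDim_eq_natCast R
    obtain ⟨x, hx⟩ := IsRegularLocalRing.exists_span_range_eq hd
    have hreg (T : Finset (Fin d)) (i : Fin d) (hi : i ∉ T) (r : R) :=
      IsRegularLocalRing.mem_span_image_of_mul_mem hx (by simp [hd]) hi (r := r)
    have hsoc := Parasolid.isSocleGenerator_paraclass hx hreg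
    have hinj := hsoc.injective (Parasolid.exists_pow_smul_eq_zero hx)
      (h d x ⟨hd, by rw [← hx, PrimeSpectrum.zeroLocus_span]⟩
        (Parasolid.paraclass_ne_zero hx hreg))
    obtain ⟨ψ, hψ⟩ := (Parasolid.baer_topCohomology hx hreg).extension_property _ hinj
      LinearMap.id
    obtain ⟨L, hL⟩ := Parasolid.exists_retraction hx hreg (LinearMap.congr_fun hψ)
    exact ⟨L, by simpa using hL⟩
  · rintro ⟨L, hL⟩ d x - hne h0
    apply hne
    have h1 := Parasolid.topCohomologyMap_comp_apply x L (Algebra.linearMap R A)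
      (Parasolid.paraclass x)
    rw [h0, map_zero, Parasolid.paraclass_eq, Parasolid.topCohomologyMap_cechClass,
      LinearMap.comp_apply, Algebra.linearMap_apply, map_one, hL] at h1
    rw [Parasolid.paraclass_eq, ← h1]
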